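/- All graphs are finite and simple. For a graph $G$ and $S\subseteq V(G)$, let $c(G-S)$ denote the number of connected components of the graph $G-S$ obtained from $G$ by deleting the vertices in $S$. For a real number $t>0$, a graph $G$ is called $t$-tough if $|S|\ge t\cdot c(G-S)$ for every $S\subseteq V(G)$ with $c(G-S)\ge 2$ (so every complete graph is $t$-tough for all $t>0$). Let $P_2\cup kP_1$ denote the disjoint union of a path on two vertices and $k$ isolated vertices; a graph is $(P_2\cup kP_1)$-free if it does not contain $P_2\cup kP_1$ as an induced subgraph. For every integer $k\ge 3$, every $(k-1)$-tough $(P_2\cup kP_1)$-free graph with at least three vertices is Hamiltonian, that is, it has a cycle containing all of its vertices. -/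

import Mathlib

namespace SimpleGraph

/-- The number `c(G - S)` of connected components of the graph obtained from `G` by deleting the
finite vertex set `S`. -/
noncomputable def numComponentsDelete {V : Type*} (G : SimpleGraph V) (S : Finset V) : ℕ :=
  Nat.card (G.induce {v : V | v ∉ S}).ConnectedComponent

/-- A finite graph `G` is `t`-tough if `|S| ≥ t * c(G - S)` for every vertex set `S` with
`c(G - S) ≥ 2`. In a complete graph there is no such `S`, so it is `t`-tough for every `t`. -/
def IsTough {V : Type*} [Fintype V] (G : SimpleGraph V) (t : ℝ) : Prop :=
  ∀ S : Finset V, 2 ≤ G.numComponentsDelete S → t * (G.numComponentsDelete S : ℝ) ≤ (S.card : ℝ)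

/-- The graph `P₂ ∪ kP₁`: the disjoint union of a path on two vertices and `k` isolated
vertices. -/
def pathTwoUnionIsolated (k : ℕ) : SimpleGraph (Fin 2 ⊕ Fin k) :=
  (pathGraph 2).sum (⊥ : SimpleGraph (Fin k))

/-- `G` is `H`-free if it does not contain `H` as an induced subgraph. -/
def IsIndFree {V W : Type*} (G : SimpleGraph V) (H : SimpleGraph W) : Prop :=
  ¬ H.IsIndContained G

end SimpleGraph

/-! Take a longest cycle and suppose that it misses a vertex. Let `K` be a component off the cycle.
Toughness gives `K` at least `2(k-1)` neighbours on the cycle, and by maximality their successors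
form an independent set `W` with no edge to `K`. Since `2(k-1) ≥ k`, an edge inside `K` together
with `W` would contain the forbidden graph, so `K = {x}` (`not_adj_outside`).

Put `I = W ∪ {x}`, an independent set of size at least `2k-1`. Call a vertex heavy if it has a
neighbour in `I`, light otherwise. By freeness a heavy vertex misses fewer than `k` elements of `I`,
and the set `L` of light vertices is independent. Rerouting the cycle shows that every vertex off it
is light, and that two consecutive heavy vertices cannot both be non-adjacent to `x`. So the
successor of a heavy vertex is light or a neighbour of `x`, whence `|Lᶜ| ≤ (|L| - 1) + |W| ≤ 2|L| -
2`. But deleting `Lᶜ` isolates all of `L`, so toughness demands `|Lᶜ| ≥ (k-1)|L| ≥ 2|L|`. -/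

namespace SimpleGraph

/-! ### Paths with a prescribed vertex set -/

section Paths

variable {V : Type*} {G : SimpleGraph V}

/-- There is a path from `a` to `b` whose vertex set is exactly `S`. -/
def HasPathOn (G : SimpleGraph V) (a b : V) (S : Finset V) : Prop :=
  ∃ p : G.Walk a b, p.IsPath ∧ ∀ v, v ∈ p.support ↔ v ∈ S

theorem HasPathOn.singleton (G : SimpleGraph V) (a : V) : G.HasPathOn a a {a} :=
  ⟨.nil, by simp, by simp⟩

theorem HasPathOn.symm {a b : V} {S : Finset V} (h : G.HasPathOn a b S) : G.HasPathOn b a S := by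
  obtain ⟨p, hp, hS⟩ := h
  exact ⟨p.reverse, hp.reverse, by simpa using hS⟩

theorem HasPathOn.append [DecidableEq V] {a b c d : V} {S T : Finset V} (h : G.HasPathOn a b S)
    (hbc : G.Adj b c) (h' : G.HasPathOn c d T) (hST : Disjoint S T) :
    G.HasPathOn a d (S ∪ T) := by
  obtain ⟨p, hp, hS⟩ := h
  obtain ⟨q, hq, hT⟩ := h'
  refine ⟨p.append (.cons hbc q), ?_, ?_⟩
  · rw [Walk.isPath_def, Walk.support_append, Walk.support_cons, List.tail_cons,
      List.nodup_append']
    refine ⟨hp.support_nodup, hq.support_nodup, fun v hv hv' => ?_⟩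
    exact Finset.disjoint_left.1 hST ((hS v).1 hv) ((hT v).1 hv')
  · intro v
    rw [Walk.support_append, Walk.support_cons, List.tail_cons, List.mem_append, hS, hT,
      Finset.mem_union]

theorem card_eq_length_add_one_of_isPath [DecidableEq V] {a b : V} {S : Finset V} {p : G.Walk a b} (hp : p.IsPath)
    (hS : ∀ v, v ∈ p.support ↔ v ∈ S) : S.card = p.length + 1 := by
  have : S = p.support.toFinset := by ext v; simp [hS]
  rw [this, List.toFinset_card_of_nodup hp.support_nodup, Walk.length_support]

/-- The edge closing a path into a cycle is new unless the path is that single edge. -/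
theorem Walk.IsPath.edge_notMem_of_two_le_length {a b : V} {p : G.Walk a b} (hp : p.IsPath)
    (h2 : 2 ≤ p.length) : s(b, a) ∉ p.edges := by
  cases p with
  | nil => simp at h2
  | cons h q =>
    rename_i c
    rw [Walk.cons_isPath_iff] at hp
    rw [Walk.edges_cons, List.mem_cons, not_or]
    refine ⟨fun he => ?_, fun he => hp.2 (q.snd_mem_support_of_mem_edges he)⟩
    have hbc : c = b := by
      rcases Sym2.eq_iff.1 he with ⟨h1, h3⟩ | ⟨h1, _⟩
      · exact h3.symm.trans h1.symm
      · exact h1.symm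
    subst hbc
    have := (Walk.isPath_iff_nil.1 hp.1).length_eq_zero
    rw [Walk.length_cons] at h2
    omega

theorem HasPathOn.isHamiltonian [Fintype V] [DecidableEq V] {a b : V} {S : Finset V}
    (h : G.HasPathOn a b S) (hab : G.Adj a b) (hS : S = Finset.univ)
    (hV : 3 ≤ Fintype.card V) : G.IsHamiltonian := by
  intro _
  obtain ⟨p, hp, hS'⟩ := h
  have hcard := card_eq_length_add_one_of_isPath hp hS'
  rw [hS, Finset.card_univ] at hcard
  refine ⟨b, .cons hab.symm p, ?_⟩
  rw [Walk.isHamiltonianCycle_isCycle_and_isHamiltonian_tail]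
  refine ⟨(Walk.cons_isCycle_iff _ _).2 ⟨hp, hp.edge_notMem_of_two_le_length (by omega)⟩, ?_⟩
  intro v
  have := hp.isHamiltonian_of_mem (fun w => (hS' w).2 (by simp [hS])) v
  simpa using this

end Paths

/-! ### Cycles as periodic sequences, and their rerouting -/

section CyclicOrder

variable {V : Type*} {G : SimpleGraph V} {f : ℕ → V} {m : ℕ}

/-- The periodic sequence `f` runs around a closed sequence of `m` distinct vertices, consecutive
ones being adjacent. For `m = 2` this is an edge traversed back and forth. -/
structure IsCyclicOrder (G : SimpleGraph V) (f : ℕ → V) (m : ℕ) : Prop where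
  pos : 0 < m
  periodic : ∀ i, f (i + m) = f i
  adj : ∀ i, G.Adj (f i) (f (i + 1))
  ne : ∀ i j, i < j → j < i + m → f i ≠ f j

theorem HasPathOn.exists_isCyclicOrder [DecidableEq V] {a b : V} {S : Finset V}
    (h : G.HasPathOn a b S) (hab : G.Adj a b) :
    ∃ f : ℕ → V, G.IsCyclicOrder f S.card ∧ ∀ v ∈ S, ∃ i, f i = v := by
  obtain ⟨p, hp, hS⟩ := h
  rw [card_eq_length_add_one_of_isPath hp hS]
  refine ⟨fun i => p.getVert (i % (p.length + 1)), ⟨by omega, ?_, ?_, ?_⟩, ?_⟩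
  · intro i; simp
  · intro i
    have hlt := Nat.mod_lt i (show 0 < p.length + 1 by omega)
    by_cases hi : i % (p.length + 1) = p.length
    · have h0 : (i + 1) % (p.length + 1) = 0 := by
        rw [Nat.add_mod, hi]
        rcases Nat.eq_zero_or_pos p.length with h | h
        · simp [h]
        · rw [Nat.mod_eq_of_lt (show 1 < p.length + 1 by omega), Nat.mod_self]
      simpa [hi, h0] using hab.symm
    · have h1 : (i + 1) % (p.length + 1) = i % (p.length + 1) + 1 := by
        rw [Nat.add_mod, Nat.mod_eq_of_lt (show 1 < p.length + 1 by omega),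
          Nat.mod_eq_of_lt (by omega)]
      simp only [h1]
      exact p.adj_getVert_succ (by omega)
  · intro i j hij hj heq
    have hi' := Nat.mod_lt i (show 0 < p.length + 1 by omega)
    have hj' := Nat.mod_lt j (show 0 < p.length + 1 by omega)
    have hm : i % (p.length + 1) = j % (p.length + 1) :=
      hp.getVert_injOn (by rw [Set.mem_ofPred]; omega) (by rw [Set.mem_ofPred]; omega) heq
    have hd := (Nat.modEq_iff_dvd' hij.le).1 hm
    have := Nat.le_of_dvd (by omega) hd
    omega
  · intro v hv
    obtain ⟨n, hn, hl⟩ := Walk.mem_support_iff_exists_getVert.1 ((hS v).2 hv)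
    exact ⟨n, by simp only [Nat.mod_eq_of_lt (show n < p.length + 1 by omega), hn]⟩

namespace IsCyclicOrder

/-- Any window of `m` consecutive indices meets every vertex, so indices can be normalised to start
at a chosen position. -/
theorem exists_index (h : G.IsCyclicOrder f m) (s i : ℕ) : ∃ j, s ≤ j ∧ j < s + m ∧ f j = f i := by
  have hmul : ∀ n i, f (i + n * m) = f i := by
    intro n
    induction n with
    | zero => simp
    | succ n ih => intro i; rw [Nat.succ_mul, ← Nat.add_assoc, h.periodic, ih]
  have hm := h.pos
  induction s with
  | zero =>
    refine ⟨i % m, by omega, by simpa using Nat.mod_lt i hm, ?_⟩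
    conv_rhs => rw [← Nat.mod_add_div i m, Nat.mul_comm, hmul]
  | succ s ih =>
    obtain ⟨j, h1, h2, h3⟩ := ih
    rcases h1.eq_or_lt with rfl | h1
    · exact ⟨s + m, by omega, by omega, by rw [h.periodic, h3]⟩
    · exact ⟨j, h1, by omega, h3⟩

theorem injOn (h : G.IsCyclicOrder f m) (s : ℕ) : Set.InjOn f (Finset.Ico s (s + m)) := by
  intro i hi j hj hij
  rw [Finset.mem_coe, Finset.mem_Ico] at hi hj
  by_contra hne
  rcases lt_or_gt_of_ne hne with hlt | hlt
  · exact h.ne i j hlt (by omega) hij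
  · exact h.ne j i hlt (by omega) hij.symm

/-- Makes the successor a function of the vertex rather than of the index. -/
theorem succ_eq_of_eq (h : G.IsCyclicOrder f m) {i j : ℕ} (hij : f i = f j) :
    f (i + 1) = f (j + 1) := by
  have key : ∀ i j, i ≤ j → f i = f j → f (i + 1) = f (j + 1) := by
    intro i j hle
    induction j using Nat.strong_induction_on with
    | _ j ih =>
      intro hij
      by_cases hlt : j < i + m
      · rcases hle.eq_or_lt with rfl | hl
        · rfl
        · exact absurd hij (h.ne i j hl hlt)
      · have hm := h.pos
        obtain ⟨l, rfl⟩ : ∃ l, j = l + m := ⟨j - m, by omega⟩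
        rw [h.periodic] at hij
        rw [Nat.add_right_comm, h.periodic]
        exact ih l (by omega) (by omega) hij
  rcases le_total i j with hle | hle
  · exact key i j hle hij
  · exact (key j i hle hij.symm).symm

theorem eq_of_succ_eq (h : G.IsCyclicOrder f m) {i j : ℕ} (hij : f (i + 1) = f (j + 1)) :
    f i = f j := by
  obtain ⟨l, h1, h2, h3⟩ := h.exists_index i j
  rw [← h3]
  rcases h1.eq_or_lt with rfl | hl
  · rfl
  · exact absurd (hij.trans (h.succ_eq_of_eq h3).symm) (h.ne (i + 1) (l + 1) (by omega) (by omega))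

variable [DecidableEq V]

theorem disjoint_image (h : G.IsCyclicOrder f m) {i j k l : ℕ} (hjk : j < k) (hl : l < i + m) :
    Disjoint ((Finset.Icc i j).image f) ((Finset.Icc k l).image f) := by
  rw [Finset.disjoint_left]
  intro v hv hv'
  obtain ⟨a, ha, rfl⟩ := Finset.mem_image.1 hv
  obtain ⟨b, hb, hab⟩ := Finset.mem_image.1 hv'
  rw [Finset.mem_Icc] at ha hb
  exact h.ne a b (by omega) (by omega) hab.symm

theorem card_image (h : G.IsCyclicOrder f m) {i j : ℕ} (hj : j < i + m) :
    ((Finset.Icc i j).image f).card = j + 1 - i := by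
  rw [Finset.card_image_of_injOn, Nat.card_Icc]
  refine (h.injOn i).mono fun a ha => ?_
  rw [Finset.mem_coe, Finset.mem_Icc] at ha
  rw [Finset.mem_coe, Finset.mem_Ico]
  omega

theorem hasPathOn (h : G.IsCyclicOrder f m) {i j : ℕ} (hij : i ≤ j) (hj : j < i + m) :
    G.HasPathOn (f i) (f j) ((Finset.Icc i j).image f) := by
  induction j, hij using Nat.le_induction with
  | base => simpa using HasPathOn.singleton G (f i)
  | succ j hij ih =>
    have hd := h.disjoint_image (k := j + 1) (Nat.lt_succ_self j) hj
    have := (ih (by omega)).append (h.adj j) (HasPathOn.singleton G (f (j + 1)))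
      (by simpa using hd)
    rwa [← Finset.image_singleton, ← Finset.image_union, ← Finset.Icc_self,
      show Finset.Icc i j ∪ Finset.Icc (j + 1) (j + 1) = Finset.Icc i (j + 1) by
        ext x; simp only [Finset.mem_union, Finset.mem_Icc]; omega] at this

theorem disjoint_image_of_forall_notMem {P : Finset V} (hP : ∀ i, f i ∉ P) (i j : ℕ) :
    Disjoint ((Finset.Icc i j).image f) P := by
  rw [Finset.disjoint_left]
  intro v hv
  obtain ⟨a, _, rfl⟩ := Finset.mem_image.1 hv
  exact hP a

/-- Replacing an edge of the cyclic order by a detour outside of it. -/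
theorem exists_hasPathOn_insert (h : G.IsCyclicOrder f m) {i : ℕ} {p q : V} {P : Finset V}
    (hpq : G.HasPathOn p q P) (hP : ∀ i, f i ∉ P) (hi : G.Adj (f i) p) :
    ∃ U, G.HasPathOn (f (i + 1)) q U ∧ U.card = m + P.card := by
  have hm := h.pos
  have h1 := h.hasPathOn (i := i + 1) (j := i + m) (by omega) (by omega)
  rw [h.periodic] at h1
  have hd := disjoint_image_of_forall_notMem hP (i + 1) (i + m)
  refine ⟨_, h1.append hi hpq hd, ?_⟩
  rw [Finset.card_union_of_disjoint hd, h.card_image (by omega)]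
  omega

/-- Two detours to the outside give a path between the successors of their ends that covers the
whole cyclic order. -/
theorem exists_hasPathOn_succ_succ (h : G.IsCyclicOrder f m) {i j : ℕ} {p q : V} {P : Finset V}
    (hpq : G.HasPathOn p q P) (hP : ∀ i, f i ∉ P) (hij : i < j) (hj : j < i + m)
    (hi : G.Adj (f i) p) (hjq : G.Adj (f j) q) :
    ∃ U, G.HasPathOn (f (i + 1)) (f (j + 1)) U ∧ U.card = m + P.card ∧
      ∀ v ∈ U, v ∈ P ∨ ∃ l, f l = v := by
  have h1 := h.hasPathOn (i := i + 1) (j := j) (by omega) (by omega)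
  have h2 := h.hasPathOn (i := j + 1) (j := i + m) (by omega) (by omega)
  rw [h.periodic] at h2
  have hd1 := disjoint_image_of_forall_notMem hP (i + 1) j
  have hd2 := disjoint_image_of_forall_notMem hP (j + 1) (i + m)
  have hd3 := h.disjoint_image (i := i + 1) (j := j) (k := j + 1) (l := i + m)
    (by omega) (by omega)
  -- The route is `f (i+1) … f j`, then `P` from `q` to `p`, then `f i` backwards to `f (j+1)`.
  have hd : Disjoint ((Finset.Icc (i + 1) j).image f ∪ P) ((Finset.Icc (j + 1) (i + m)).image f) :=
    Finset.disjoint_union_left.2 ⟨hd3, hd2.symm⟩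
  refine ⟨_, (h1.append hjq hpq.symm hd1).append hi.symm h2.symm hd, ?_, ?_⟩
  · rw [Finset.card_union_of_disjoint hd, Finset.card_union_of_disjoint hd1,
      h.card_image (by omega), h.card_image (by omega)]
    omega
  · intro v hv
    simp only [Finset.mem_union, Finset.mem_image] at hv
    rcases hv with (⟨a, _, rfl⟩ | hv) | ⟨a, _, rfl⟩
    · exact .inr ⟨a, rfl⟩
    · exact .inl hv
    · exact .inr ⟨a, rfl⟩

/-- Two chords from the ends of an edge to the successors of two neighbours of an outside vertex
give a closed sequence through that vertex. -/
theorem exists_hasPathOn_crossing (h : G.IsCyclicOrder f m) {t i j : ℕ} {x : V}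
    (hx : ∀ i, f i ≠ x) (hti : t < i) (hij : i < j) (hj : j < t + m)
    (hix : G.Adj (f i) x) (hjx : G.Adj (f j) x) (hjt : G.Adj (f (j + 1)) (f (t + 1))) :
    ∃ U, G.HasPathOn (f t) (f (i + 1)) U ∧ U.card = m + 1 := by
  have h1 := h.hasPathOn (i := t + 1) (j := i) (by omega) (by omega)
  have h2 := h.hasPathOn (i := i + 1) (j := j) (by omega) (by omega)
  have h3 := h.hasPathOn (i := j + 1) (j := t + m) (by omega) (by omega)
  rw [h.periodic] at h3
  have hP : ∀ i, f i ∉ ({x} : Finset V) := by simpa using hx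
  have d1 := disjoint_image_of_forall_notMem hP (t + 1) i
  have d2 := disjoint_image_of_forall_notMem hP (i + 1) j
  have d3 := disjoint_image_of_forall_notMem hP (j + 1) (t + m)
  have d12 := h.disjoint_image (i := t + 1) (j := i) (k := i + 1) (l := j) (by omega) (by omega)
  have d13 := h.disjoint_image (i := t + 1) (j := i) (k := j + 1) (l := t + m)
    (by omega) (by omega)
  have d23 := h.disjoint_image (i := i + 1) (j := j) (k := j + 1) (l := t + m)
    (by omega) (by omega)
  -- The route is `f t` backwards to `f (j+1)`, the chord to `f (t+1)`, forwards to `f i`, through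
  -- `x` to `f j`, backwards to `f (i+1)`.
  have e1 := h3.symm.append hjt h1 d13.symm
  have c1 := Finset.card_union_of_disjoint d13.symm
  have dd := Finset.disjoint_union_left.2 ⟨d3, d1⟩
  have e2 := e1.append hix (HasPathOn.singleton G x) dd
  have c2 := Finset.card_union_of_disjoint dd
  have ddd := Finset.disjoint_union_left.2 ⟨Finset.disjoint_union_left.2 ⟨d23.symm, d12⟩, d2.symm⟩
  have e3 := e2.append hjx.symm h2.symm ddd
  have c3 := Finset.card_union_of_disjoint ddd
  refine ⟨_, e3, ?_⟩
  rw [c3, c2, c1, h.card_image (by omega), h.card_image (by omega), h.card_image (by omega),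
    Finset.card_singleton]
  omega

end IsCyclicOrder

end CyclicOrder

/-! ### Consequences of toughness and of the forbidden subgraph -/

section Toughness

variable {V : Type*} {G : SimpleGraph V}

theorem mem_of_reachable_of_closed {W : Type*} {H : SimpleGraph W} {K : Set W}
    (hK : ∀ u v, u ∈ K → H.Adj u v → v ∈ K) {u v : W} (huv : H.Reachable u v) (hu : u ∈ K) :
    v ∈ K := by
  obtain ⟨p⟩ := huv
  induction p with
  | nil => exact hu
  | cons h q ih => exact ih (hK _ _ hu h)

theorem two_le_numComponentsDelete [Finite V] {S : Finset V} {K : Set V}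
    (hK : ∀ u v, u ∈ K → G.Adj u v → v ∉ S → v ∈ K) {u v : V} (hu : u ∈ K) (huS : u ∉ S)
    (hv : v ∉ K) (hvS : v ∉ S) : 2 ≤ G.numComponentsDelete S := by
  have : Nontrivial (G.induce {v : V | v ∉ S}).ConnectedComponent := by
    refine ⟨connectedComponentMk _ ⟨u, huS⟩, connectedComponentMk _ ⟨v, hvS⟩, fun h => hv ?_⟩
    exact mem_of_reachable_of_closed (K := Subtype.val ⁻¹' K)
      (fun a b ha hab => hK _ _ ha (by simpa using hab) b.2) (ConnectedComponent.exact h) hu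
  exact Finite.one_lt_card

/-- Each vertex of `L` is isolated once `S` is deleted, so it is a component by itself. -/
theorem card_le_numComponentsDelete [Finite V] {S L : Finset V} (hLS : Disjoint L S)
    (hL : ∀ u ∈ L, ∀ v, G.Adj u v → v ∈ S) : L.card ≤ G.numComponentsDelete S := by
  have hmem : ∀ u ∈ L, u ∈ {v : V | v ∉ S} := fun u hu => Finset.disjoint_left.1 hLS hu
  rw [← Nat.card_eq_finsetCard L]
  refine Nat.card_le_card_of_injective
    (fun u : L => connectedComponentMk (G.induce {v : V | v ∉ S}) ⟨u, hmem u u.2⟩) ?_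
  intro u v h
  have hclosed : ∀ a b, a ∈ {a : {v : V | v ∉ S} | a.1 = u.1} →
      (G.induce {v : V | v ∉ S}).Adj a b → b ∈ {a : {v : V | v ∉ S} | a.1 = u.1} := by
    intro a b ha hab
    have hab' : G.Adj a.1 b.1 := by simpa using hab
    rw [show a.1 = u.1 from ha] at hab'
    exact absurd (hL u u.2 b hab') b.2
  have huv : v.1 = u.1 :=
    mem_of_reachable_of_closed hclosed (ConnectedComponent.exact h) (show u.1 = u.1 from rfl)
  exact Subtype.ext huv.symm

theorem IsTough.mul_le_card [Fintype V] {k : ℕ} (hk : 1 ≤ k)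
    (h : G.IsTough ((k : ℝ) - 1)) {S : Finset V} {c : ℕ} (hc : 2 ≤ c)
    (hcS : c ≤ G.numComponentsDelete S) : (k - 1) * c ≤ S.card := by
  have h1 := h S (hc.trans hcS)
  rw [← Nat.cast_one, ← Nat.cast_sub hk] at h1
  exact (Nat.mul_le_mul_left _ hcS).trans (by exact_mod_cast h1)

theorem IsIndFree.card_lt [Fintype V] {k : ℕ} (h : G.IsIndFree (pathTwoUnionIsolated k))
    {u v : V} (huv : G.Adj u v) {T : Finset V}
    (hT : ∀ a ∈ T, ∀ b ∈ T, ¬ G.Adj a b) (hu : ∀ a ∈ T, a ≠ u ∧ ¬ G.Adj u a)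
    (hv : ∀ a ∈ T, a ≠ v ∧ ¬ G.Adj v a) : T.card < k := by
  by_contra! hk
  obtain ⟨T', hT', hcard⟩ := Finset.exists_subset_card_eq hk
  let e : Fin k ≃ T' := (T'.equivFinOfCardEq hcard).symm
  have he : ∀ i, (e i : V) ∈ T := fun i => hT' (e i).2
  refine h ⟨⟨⟨Sum.elim ![u, v] (fun i => (e i : V)), ?_⟩, ?_⟩⟩
  · have hne := huv.ne
    rintro (a | a) (b | b) hab
    · fin_cases a <;> fin_cases b <;> simp_all [hne.symm]
    · fin_cases a
      · exact absurd hab.symm (hu _ (he b)).1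
      · exact absurd hab.symm (hv _ (he b)).1
    · fin_cases b
      · exact absurd hab (hu _ (he a)).1
      · exact absurd hab (hv _ (he a)).1
    · simpa [Subtype.ext_iff] using hab
  · intro a b
    change G.Adj (Sum.elim ![u, v] (fun i => (e i : V)) a)
      (Sum.elim ![u, v] (fun i => (e i : V)) b) ↔ _
    rcases a with a | a <;> rcases b with b | b
    · fin_cases a <;> fin_cases b <;>
        simp [pathTwoUnionIsolated, pathGraph_adj, huv, huv.symm]
    · have h1 := (hu _ (he b)).2
      have h2 := (hv _ (he b)).2
      fin_cases a <;> simp [pathTwoUnionIsolated, h1, h2]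
    · have h1 := (hu _ (he a)).2
      have h2 := (hv _ (he a)).2
      rw [G.adj_comm] at h1 h2
      fin_cases b <;> simp [pathTwoUnionIsolated, h1, h2]
    · simpa [pathTwoUnionIsolated] using hT _ (he a) _ (he b)

/-- In an edgeless graph, deleting nothing already leaves at least two components. -/
theorem IsTough.exists_adj [Fintype V] {k : ℕ} (hk : 2 ≤ k)
    (ht : G.IsTough ((k : ℝ) - 1)) (hV : 2 ≤ Fintype.card V) : ∃ u v, G.Adj u v := by
  by_contra! hG
  have := ht.mul_le_card (k := k) (by omega) (c := (Finset.univ : Finset V).card) hV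
    (card_le_numComponentsDelete (S := ∅) (by simp) fun u _ v huv => absurd huv (hG u v))
  rw [Finset.card_empty, Finset.card_univ] at this
  have := Nat.mul_le_mul_right (Fintype.card V) (show 1 ≤ k - 1 by omega)
  omega

end Toughness

/-! ### Structure around a longest cycle -/

section LongestCycle

variable {V : Type*} {G : SimpleGraph V} {f : ℕ → V} {m : ℕ}

theorem HasPathOn.card_pos {a b : V} {S : Finset V} (h : G.HasPathOn a b S) : 0 < S.card := by
  obtain ⟨p, _, hS⟩ := h
  exact Finset.card_pos.2 ⟨a, (hS a).1 p.start_mem_support⟩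

/-- A cyclic order of maximum length. -/
structure IsLongestCyclicOrder (G : SimpleGraph V) (f : ℕ → V) (m : ℕ) : Prop
    extends G.IsCyclicOrder f m where
  card_le : ∀ a b S, G.Adj a b → G.HasPathOn a b S → S.card ≤ m

/-- The set `K` is a union of connected components outside of the cyclic order `f`, any two
vertices of which are joined by a path in `K`. -/
structure IsOuterPiece (G : SimpleGraph V) (f : ℕ → V) (K : Set V) : Prop where
  nonempty : K.Nonempty
  notMem : ∀ i, f i ∉ K
  closed : ∀ u v, u ∈ K → G.Adj u v → (∀ i, f i ≠ v) → v ∈ K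
  exists_path : ∀ p ∈ K, ∀ q ∈ K, ∃ P : Finset V, G.HasPathOn p q P ∧ ∀ v ∈ P, v ∈ K

theorem exists_isOuterPiece (G : SimpleGraph V) (f : ℕ → V) {x : V} (hx : ∀ i, f i ≠ x) :
    ∃ K, G.IsOuterPiece f K ∧ x ∈ K := by
  classical
  let H := G.induce {v : V | ∀ i, f i ≠ v}
  refine ⟨Subtype.val '' {w | H.Reachable ⟨x, hx⟩ w}, ⟨⟨x, ⟨x, hx⟩, .refl _, rfl⟩, ?_, ?_, ?_⟩,
    ⟨x, hx⟩, .refl _, rfl⟩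
  · rintro i ⟨w, _, hw⟩
    exact w.2 i hw.symm
  · rintro _ v ⟨u, hu, rfl⟩ huv hv
    have : H.Adj u ⟨v, hv⟩ := by simpa [H] using huv
    exact ⟨⟨v, hv⟩, hu.trans this.reachable, rfl⟩
  · rintro _ ⟨p, hp, rfl⟩ _ ⟨q, hq, rfl⟩
    obtain ⟨w, hw⟩ := (hp.symm.trans hq).exists_isPath
    let e : H ↪g G := Embedding.induce _
    refine ⟨(w.map e.toHom).support.toFinset, ⟨w.map e.toHom, hw.map e.injective,
      fun v => List.mem_toFinset.symm⟩, ?_⟩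
    intro v hv
    rw [List.mem_toFinset, Walk.support_map, List.mem_map] at hv
    obtain ⟨u, hu, rfl⟩ := hv
    exact ⟨u, hp.trans ⟨w.takeUntil u hu⟩, rfl⟩

open Classical in
/-- The positions in one period of the vertices with a neighbour in `K`. -/
noncomputable def attachments (G : SimpleGraph V) (f : ℕ → V) (m : ℕ) (K : Set V) : Finset ℕ :=
  (Finset.range m).filter fun i => ∃ p ∈ K, G.Adj (f i) p

theorem mem_attachments {K : Set V} {i : ℕ} :
    i ∈ G.attachments f m K ↔ i < m ∧ ∃ p ∈ K, G.Adj (f i) p := by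
  simp only [attachments, Finset.mem_filter, Finset.mem_range]

theorem attachments_subset (K : Set V) : G.attachments f m K ⊆ Finset.range m :=
  fun _ hi => Finset.mem_range.2 (mem_attachments.1 hi).1

variable [DecidableEq V]

theorem IsCyclicOrder.mem_image_attachments (h : G.IsCyclicOrder f m) {K : Set V} {i : ℕ}
    (hi : ∃ p ∈ K, G.Adj (f i) p) : f i ∈ (G.attachments f m K).image f := by
  obtain ⟨j, _, h2, h3⟩ := h.exists_index 0 i
  refine Finset.mem_image.2 ⟨j, ?_, h3⟩
  rw [mem_attachments, h3]
  exact ⟨by omega, hi⟩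

theorem IsCyclicOrder.card_image_of_subset_range (h : G.IsCyclicOrder f m) {J : Finset ℕ}
    (hJ : J ⊆ Finset.range m) : (J.image f).card = J.card := by
  refine Finset.card_image_of_injOn ((h.injOn 0).mono fun i hi => ?_)
  simpa using hJ hi

theorem IsCyclicOrder.card_image_succ_of_subset_range (h : G.IsCyclicOrder f m) {J : Finset ℕ}
    (hJ : J ⊆ Finset.range m) : (J.image fun i => f (i + 1)).card = J.card := by
  refine Finset.card_image_of_injOn fun i hi j hj hij => ?_
  exact h.injOn 0 (by simpa using hJ hi) (by simpa using hJ hj) (h.eq_of_succ_eq hij)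

/-- The successors of the vertices with a neighbour in `K`. -/
noncomputable def successors (G : SimpleGraph V) (f : ℕ → V) (m : ℕ) (K : Set V) : Finset V :=
  (G.attachments f m K).image fun i => f (i + 1)

theorem mem_successors {K : Set V} {v : V} (hv : v ∈ G.successors f m K) :
    ∃ i, f (i + 1) = v ∧ ∃ p ∈ K, G.Adj (f i) p := by
  obtain ⟨i, hi, rfl⟩ := Finset.mem_image.1 hv
  exact ⟨i, rfl, (mem_attachments.1 hi).2⟩

theorem IsCyclicOrder.succ_mem_successors (h : G.IsCyclicOrder f m) {K : Set V} {i : ℕ}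
    (hi : ∃ p ∈ K, G.Adj (f i) p) : f (i + 1) ∈ G.successors f m K := by
  obtain ⟨j, hj, hji⟩ := Finset.mem_image.1 (h.mem_image_attachments hi)
  exact Finset.mem_image.2 ⟨j, hj, h.succ_eq_of_eq hji⟩

namespace IsLongestCyclicOrder

variable {K : Set V}

/-- Otherwise a detour through `K` could replace the edge from `f i` to `f (i+1)`, lengthening the
cycle. -/
theorem not_adj_succ (h : G.IsLongestCyclicOrder f m) (hK : G.IsOuterPiece f K) {i : ℕ} {p q : V}
    (hp : p ∈ K) (hq : q ∈ K) (hi : G.Adj (f i) p) : ¬ G.Adj (f (i + 1)) q := by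
  intro hiq
  obtain ⟨P, hP, hPK⟩ := hK.exists_path p hp q hq
  obtain ⟨U, hU, hc⟩ := h.exists_hasPathOn_insert hP (fun j hj => hK.notMem j (hPK _ hj)) hi
  have := h.card_le _ _ _ hiq hU
  have := hP.card_pos
  omega

theorem exists_hasPathOn_succ_succ_of_ne (h : G.IsLongestCyclicOrder f m)
    (hK : G.IsOuterPiece f K) {i j : ℕ} {p q : V} (hp : p ∈ K) (hq : q ∈ K) (hij : f i ≠ f j)
    (hi : G.Adj (f i) p) (hj : G.Adj (f j) q) :
    ∃ U, G.HasPathOn (f (i + 1)) (f (j + 1)) U ∧ m < U.card ∧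
      ∀ v ∈ U, v ∈ K ∨ ∃ l, f l = v := by
  obtain ⟨P, hP, hPK⟩ := hK.exists_path p hp q hq
  obtain ⟨l, h1, h2, h3⟩ := h.exists_index i j
  obtain ⟨U, hU, hc, hU'⟩ := h.exists_hasPathOn_succ_succ hP
    (fun j hj => hK.notMem j (hPK _ hj)) (h1.lt_of_ne (by rintro rfl; exact hij h3)) h2 hi
    (h3 ▸ hj)
  rw [h.succ_eq_of_eq h3] at hU
  have := hP.card_pos
  exact ⟨U, hU, by omega, fun v hv => (hU' v hv).imp_left (hPK v)⟩

theorem not_adj_of_mem_successors (h : G.IsLongestCyclicOrder f m) (hK : G.IsOuterPiece f K)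
    {a b : V} (ha : a ∈ G.successors f m K) (hb : b ∈ G.successors f m K) : ¬ G.Adj a b := by
  obtain ⟨i, rfl, p, hp, hi⟩ := mem_successors ha
  obtain ⟨j, rfl, q, hq, hj⟩ := mem_successors hb
  intro hab
  obtain ⟨U, hU, hc, _⟩ := h.exists_hasPathOn_succ_succ_of_ne hK hp hq
    (fun hij => hab.ne (h.succ_eq_of_eq hij)) hi hj
  have := h.card_le _ _ _ hab hU
  omega

theorem not_adj_of_mem_successors_of_mem (h : G.IsLongestCyclicOrder f m)
    (hK : G.IsOuterPiece f K) {a u : V} (ha : a ∈ G.successors f m K) (hu : u ∈ K) :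
    ¬ G.Adj a u := by
  obtain ⟨i, rfl, p, hp, hi⟩ := mem_successors ha
  exact h.not_adj_succ hK hp hu hi

theorem card_successors (h : G.IsLongestCyclicOrder f m) (K : Set V) :
    (G.successors f m K).card = (G.attachments f m K).card :=
  h.card_image_succ_of_subset_range (attachments_subset K)

/-- Deleting the neighbours of `K` on the cycle separates `K` from the rest of the cycle. Something
does remain there, because consecutive vertices are never both attached to `K`. -/
theorem two_mul_le_card_attachments [Fintype V] (h : G.IsLongestCyclicOrder f m)
    (hK : G.IsOuterPiece f K) {k : ℕ} (hk : 1 ≤ k) (ht : G.IsTough ((k : ℝ) - 1)) :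
    (k - 1) * 2 ≤ (G.attachments f m K).card := by
  rw [← h.card_image_of_subset_range (attachments_subset K)]
  obtain ⟨u, hu⟩ := hK.nonempty
  have hS : ∀ v ∈ (G.attachments f m K).image f, ∃ i, f i = v ∧ ∃ p ∈ K, G.Adj (f i) p := by
    intro v hv
    obtain ⟨i, hi, rfl⟩ := Finset.mem_image.1 hv
    exact ⟨i, rfl, (mem_attachments.1 hi).2⟩
  obtain ⟨i, hi⟩ : ∃ i, f i ∉ (G.attachments f m K).image f := by
    by_cases h0 : f 0 ∈ (G.attachments f m K).image f
    · obtain ⟨i, hi0, p, hp, hip⟩ := hS _ h0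
      refine ⟨i + 1, fun h1 => ?_⟩
      obtain ⟨j, hj, q, hq, hjq⟩ := hS _ h1
      exact h.not_adj_succ hK hp hq hip (hj ▸ hjq)
    · exact ⟨0, h0⟩
  refine ht.mul_le_card hk le_rfl (two_le_numComponentsDelete (K := K) ?_ hu ?_ (hK.notMem i) hi)
  · intro a b ha hab hb
    refine hK.closed a b ha hab ?_
    rintro j rfl
    exact hb (h.mem_image_attachments ⟨a, ha, hab.symm⟩)
  · intro hu'
    obtain ⟨j, rfl, _⟩ := hS _ hu'
    exact hK.notMem j hu

theorem not_adj_outside [Fintype V] (h : G.IsLongestCyclicOrder f m) {k : ℕ} (hk : 2 ≤ k)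
    (ht : G.IsTough ((k : ℝ) - 1)) (hfree : G.IsIndFree (pathTwoUnionIsolated k)) {x y : V}
    (hx : ∀ i, f i ≠ x) (hy : ∀ i, f i ≠ y) : ¬ G.Adj x y := by
  intro hxy
  obtain ⟨K, hK, hxK⟩ := exists_isOuterPiece G f hx
  have hyK := hK.closed x y hxK hxy hy
  have hcard := h.two_mul_le_card_attachments hK (by omega) ht
  rw [← h.card_successors K] at hcard
  have key : ∀ u ∈ K, ∀ a ∈ G.successors f m K, a ≠ u ∧ ¬ G.Adj u a := by
    refine fun u hu a ha => ⟨?_, fun hua => ?_⟩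
    · rintro rfl
      obtain ⟨i, hi, _⟩ := mem_successors ha
      exact hK.notMem (i + 1) (hi ▸ hu)
    · exact h.not_adj_of_mem_successors_of_mem hK ha hu hua.symm
  have := hfree.card_lt hxy (fun a ha b hb => h.not_adj_of_mem_successors hK ha hb)
    (key x hxK) (key y hyK)
  omega

/-- No vertex outside of a longest cyclic order of a `(k - 1)`-tough `(P₂ ∪ kP₁)`-free graph. -/
theorem exists_index_eq [Fintype V] (h : G.IsLongestCyclicOrder f m) {k : ℕ} (hk : 3 ≤ k)
    (ht : G.IsTough ((k : ℝ) - 1)) (hfree : G.IsIndFree (pathTwoUnionIsolated k)) (x : V) :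
    ∃ i, f i = x := by
  classical
  by_contra! hx
  have hout : ∀ y, (∀ i, f i ≠ y) → ¬ G.Adj x y :=
    fun y hy => h.not_adj_outside (by omega) ht hfree hx hy
  have hK : G.IsOuterPiece f {x} := by
    refine ⟨⟨x, rfl⟩, hx, ?_, ?_⟩
    · rintro u v rfl huv hv
      exact absurd huv (hout v hv)
    · rintro p rfl q rfl
      exact ⟨{q}, .singleton G q, by simp⟩
  set W := G.successors f m {x} with hW
  have hd := h.two_mul_le_card_attachments hK (by omega) ht
  have hWcard : W.card = (G.attachments f m {x}).card := h.card_successors _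
  have hxW : x ∉ W := fun hxW => by
    obtain ⟨i, hi, _⟩ := mem_successors hxW
    exact hx _ hi
  have hWmem : ∀ a ∈ W, ∃ i, f (i + 1) = a ∧ G.Adj (f i) x := by
    intro a ha
    obtain ⟨i, hi, p, rfl, hp⟩ := mem_successors ha
    exact ⟨i, hi, hp⟩
  set I := insert x W with hI
  have hIcard : I.card = W.card + 1 := Finset.card_insert_of_notMem hxW
  have hindep : ∀ a ∈ I, ∀ b ∈ I, ¬ G.Adj a b := by
    intro a ha b hb
    rcases Finset.mem_insert.1 ha with rfl | ha <;> rcases Finset.mem_insert.1 hb with rfl | hb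
    · exact G.irrefl
    · exact fun hab => h.not_adj_of_mem_successors_of_mem hK hb rfl hab.symm
    · exact h.not_adj_of_mem_successors_of_mem hK ha rfl
    · exact h.not_adj_of_mem_successors hK ha hb
  have hmem : ∀ {u a}, ¬ G.Adj u x → G.Adj u a → a ∈ I → a ∈ W := by
    intro u a hux hua ha
    rcases Finset.mem_insert.1 ha with rfl | ha
    · exact absurd hua hux
    · exact ha
  -- The edge `ub` and the non-neighbours of `u` in `I` induce a `P₂` plus isolated vertices.
  have hheavy : ∀ u, (∃ b ∈ I, G.Adj u b) → (I.filter fun a => ¬ G.Adj u a).card < k := by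
    rintro u ⟨b, hb, hub⟩
    refine hfree.card_lt hub ?_ ?_ ?_
    · exact fun a ha c hc => hindep a (Finset.mem_filter.1 ha).1 c (Finset.mem_filter.1 hc).1
    · intro a ha
      refine ⟨?_, (Finset.mem_filter.1 ha).2⟩
      rintro rfl
      exact hindep a (Finset.mem_filter.1 ha).1 b hb hub
    · intro a ha
      refine ⟨?_, hindep b hb a (Finset.mem_filter.1 ha).1⟩
      rintro rfl
      exact (Finset.mem_filter.1 ha).2 hub
  have hsplit : ∀ u, (I.filter fun a => G.Adj u a).card + (I.filter fun a => ¬ G.Adj u a).card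
      = I.card := fun u => Finset.card_filter_add_card_filter_not _
  have hlight : ∀ u v, (∀ a ∈ I, ¬ G.Adj u a) → (∀ a ∈ I, ¬ G.Adj v a) → ¬ G.Adj u v := by
    intro u v hu hv huv
    have := hfree.card_lt huv hindep
      (fun a ha => ⟨by rintro rfl; exact hv a ha huv.symm, hu a ha⟩)
      (fun a ha => ⟨by rintro rfl; exact hu a ha huv, hv a ha⟩)
    omega
  have houtside : ∀ y, (∀ i, f i ≠ y) → ∀ a ∈ I, ¬ G.Adj y a := by
    intro y hy
    by_contra! hya
    have hyx : ¬ G.Adj y x := fun hyx => hout y hy hyx.symm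
    have hne : x ≠ y := by
      rintro rfl
      obtain ⟨a, ha, hxa⟩ := hya
      exact hindep x (Finset.mem_insert_self _ _) a ha hxa
    have h1 := hheavy y hya
    have h2 := hsplit y
    -- Of at least `2k-1` elements of `I`, `y` misses at most `k-1`. Its neighbours lie in `W`, and
    -- a path through `x` joining two of them closes up through `y`.
    obtain ⟨a, ha, b, hb, hab⟩ := Finset.one_lt_card.1
      (show 1 < (I.filter fun a => G.Adj y a).card by omega)
    rw [Finset.mem_filter] at ha hb
    obtain ⟨i, rfl, hi⟩ := hWmem a (hmem hyx ha.2 ha.1)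
    obtain ⟨j, rfl, hj⟩ := hWmem b (hmem hyx hb.2 hb.1)
    obtain ⟨U, hU, hc, hU'⟩ := h.exists_hasPathOn_succ_succ_of_ne hK rfl rfl
      (fun hij => hab (h.succ_eq_of_eq hij)) hi hj
    have hyU : Disjoint U {y} := by
      rw [Finset.disjoint_singleton_right]
      intro hyU
      rcases hU' y hyU with hxy | ⟨l, hl⟩
      · exact hne hxy.symm
      · exact hy l hl
    have := h.card_le _ _ _ ha.2.symm (hU.append hb.2.symm (.singleton G y) hyU)
    rw [Finset.card_union_of_disjoint hyU] at this
    omega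
  have hedge : ∀ t, (∃ a ∈ I, G.Adj (f t) a) → (∃ a ∈ I, G.Adj (f (t + 1)) a) →
      ¬ G.Adj (f t) x → ¬ G.Adj (f (t + 1)) x → False := by
    intro t h1 h2 h1x h2x
    have c1 := hheavy _ h1
    have c2 := hheavy _ h2
    -- Both ends miss `x`, so together they miss at most `2(k-1) - 1 = 2k-3` elements of `I`; at
    -- least two common neighbours remain.
    have hinter : 0 < ((I.filter fun a => ¬ G.Adj (f t) a) ∩
        (I.filter fun a => ¬ G.Adj (f (t + 1)) a)).card := by
      refine Finset.card_pos.2 ⟨x, ?_⟩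
      simp [hI, h1x, h2x]
    have hunion := Finset.card_union_add_card_inter (I.filter fun a => ¬ G.Adj (f t) a)
      (I.filter fun a => ¬ G.Adj (f (t + 1)) a)
    rw [← Finset.filter_or] at hunion
    have hs : (I.filter fun a => (¬ G.Adj (f t) a ∨ ¬ G.Adj (f (t + 1)) a)).card +
      (I.filter fun a => ¬ (¬ G.Adj (f t) a ∨ ¬ G.Adj (f (t + 1)) a)).card = I.card :=
        Finset.card_filter_add_card_filter_not _
    obtain ⟨a, ha, b, hb, hab⟩ := Finset.one_lt_card.1
      (show 1 < (I.filter fun a => ¬ (¬ G.Adj (f t) a ∨ ¬ G.Adj (f (t + 1)) a)).card by omega)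
    simp only [Finset.mem_filter, not_or, not_not] at ha hb
    -- Both common neighbours see both ends of the edge, so whichever comes earlier after `t` can
    -- take the chord from `f t`, and the other the chord from `f (t+1)`.
    have key : ∀ i j, t ≤ i → i < j → j < t + m → G.Adj (f i) x → G.Adj (f j) x →
        G.Adj (f t) (f (i + 1)) → G.Adj (f (t + 1)) (f (j + 1)) → False := by
      intro i j hti hij hj hix hjx hit hjt
      rcases hti.eq_or_lt with rfl | hti
      · exact h1x hix
      · obtain ⟨U, hU, hc⟩ := h.exists_hasPathOn_crossing hx hti hij hj hix hjx hjt.symm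
        have := h.card_le _ _ _ hit hU
        omega
    obtain ⟨i, rfl, hi⟩ := hWmem a (hmem h1x ha.2.1 ha.1)
    obtain ⟨j, rfl, hj⟩ := hWmem b (hmem h1x hb.2.1 hb.1)
    obtain ⟨i', i1, i2, i3⟩ := h.exists_index t i
    obtain ⟨j', j1, j2, j3⟩ := h.exists_index t j
    rw [← h.succ_eq_of_eq i3] at ha hab
    rw [← h.succ_eq_of_eq j3] at hb hab
    rw [← i3] at hi
    rw [← j3] at hj
    rcases lt_trichotomy i' j' with hlt | rfl | hlt
    · exact key i' j' i1 hlt j2 hi hj ha.2.1 hb.2.2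
    · exact hab rfl
    · exact key j' i' j1 hlt i2 hj hi hb.2.1 ha.2.2
  set L := Finset.univ.filter fun v => ∀ a ∈ I, ¬ G.Adj v a with hL
  have hIL : I ⊆ L := fun a ha => by simpa [hL] using hindep a ha
  have hxL : x ∈ L := hIL (Finset.mem_insert_self _ _)
  have hLI := Finset.card_le_card hIL
  have hcount : Lᶜ.card ≤ (L.erase x).card + W.card := by
    set J := (Finset.range m).filter fun i => f i ∉ L with hJ
    have hJsub : J ⊆ Finset.range m := Finset.filter_subset _ _
    have h1 : Lᶜ ⊆ J.image f := by
      intro v hv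
      rw [Finset.mem_compl] at hv
      obtain ⟨i, hi⟩ : ∃ i, f i = v := by
        by_contra! hv'
        exact hv (by simpa [hL] using houtside v hv')
      obtain ⟨j, _, j2, j3⟩ := h.exists_index 0 i
      refine Finset.mem_image.2 ⟨j, Finset.mem_filter.2 ⟨by simpa using j2, ?_⟩, j3.trans hi⟩
      rwa [j3, hi]
    -- A light successor differs from `x` because it is on the cycle; this saves the one vertex that
    -- makes the final inequality strict.
    have h2 : (J.image fun i => f (i + 1)) ⊆
        L.erase x ∪ (G.attachments f m {x}).image f := by
      intro v hv
      obtain ⟨t, ht, rfl⟩ := Finset.mem_image.1 hv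
      have htL := (Finset.mem_filter.1 ht).2
      rw [Finset.mem_union, Finset.mem_erase]
      by_cases hsL : f (t + 1) ∈ L
      · exact .inl ⟨hx _, hsL⟩
      · by_cases hsx : G.Adj (f (t + 1)) x
        · exact .inr (h.mem_image_attachments ⟨x, rfl, hsx⟩)
        · by_cases htx : G.Adj (f t) x
          · exact absurd (hIL (Finset.mem_insert_of_mem (h.succ_mem_successors ⟨x, rfl, htx⟩))) hsL
          · refine (hedge t ?_ ?_ htx hsx).elim
            · simpa [hL] using htL
            · simpa [hL] using hsL
    calc Lᶜ.card ≤ (J.image f).card := Finset.card_le_card h1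
      _ = (J.image fun i => f (i + 1)).card := by
        rw [h.card_image_of_subset_range hJsub, h.card_image_succ_of_subset_range hJsub]
      _ ≤ _ := Finset.card_le_card h2
      _ ≤ _ := Finset.card_union_le _ _
      _ = _ := by rw [h.card_image_of_subset_range (attachments_subset _), hWcard]
  rw [Finset.card_erase_of_mem hxL] at hcount
  have htoughL := ht.mul_le_card (k := k) (by omega) (show 2 ≤ L.card by omega)
    (card_le_numComponentsDelete (S := Lᶜ) disjoint_compl_right (by
      intro u hu v huv
      rw [Finset.mem_compl]
      intro hv
      exact hlight u v (by simpa [hL] using hu) (by simpa [hL] using hv) huv))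
  -- Here `k ≥ 3` is essential: `2|L| ≤ |Lᶜ|` contradicts `|Lᶜ| ≤ (|L| - 1) + |W|`, as `|W| + 1 =
  -- |I| ≤ |L|`.
  have := Nat.mul_le_mul_right L.card (show 2 ≤ k - 1 by omega)
  omega

end IsLongestCyclicOrder

end LongestCycle

end SimpleGraph

theorem mainTheorem3 {V : Type*} [Fintype V] [DecidableEq V] (G : SimpleGraph V)
    (hV : 3 ≤ Fintype.card V) (k : ℕ) (hk : 3 ≤ k)
    (htough : G.IsTough ((k : ℝ) - 1))
    (hfree : G.IsIndFree (SimpleGraph.pathTwoUnionIsolated k)) :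
    G.IsHamiltonian := by
  classical
  obtain ⟨u, v, huv⟩ := htough.exists_adj (by omega) (by omega)
  have hpath := (SimpleGraph.HasPathOn.singleton G u).append huv (.singleton G v)
    (by simpa using huv.ne)
  obtain ⟨S, hS, hmax⟩ := Finset.exists_max_image
    (Finset.univ.filter fun S : Finset V => ∃ a b, G.Adj a b ∧ G.HasPathOn a b S) Finset.card
    ⟨_, Finset.mem_filter.2 ⟨Finset.mem_univ _, u, v, huv, hpath⟩⟩
  obtain ⟨a, b, hab, hS⟩ := (Finset.mem_filter.1 hS).2
  obtain ⟨f, hf, -⟩ := hS.exists_isCyclicOrder hab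
  have hlong : G.IsLongestCyclicOrder f S.card :=
    ⟨hf, fun a b T hab hT => hmax T (Finset.mem_filter.2 ⟨Finset.mem_univ _, a, b, hab, hT⟩)⟩
  refine hS.isHamiltonian hab ?_ hV
  -- Only the size of `S` is compared with `f`: one period covers all vertices without repetition,
  -- so `S` has as many elements as `V`.
  have huniv : (Finset.range S.card).image f = Finset.univ := by
    refine Finset.eq_univ_of_forall fun x => ?_
    obtain ⟨i, rfl⟩ := hlong.exists_index_eq hk htough hfree x
    obtain ⟨j, _, h2, h3⟩ := hf.exists_index 0 i
    exact Finset.mem_image.2 ⟨j, by simpa using h2, h3⟩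
  have hcard := hf.card_image_of_subset_range subset_rfl
  rw [huniv, Finset.card_range] at hcard
  exact (Finset.card_eq_iff_eq_univ S).1 hcard.symm
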